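/- For integers $m\ge 3$ and $c$ let $P(m,c)=\frac{c}{2}\{(m-2)c-(m-4)\}$ be the $c$-th $m$-gonal number, where the index $c$ ranges over the positive integers if $m\in\{3,4\}$ and over all integers if $m>4$. For positive integers $n$ and $t$, let $r_{m,t}(n)$ be the number of representations $n=a+b$ with positive integers $a,b$ (the order of the summands being disregarded) such that $ab=tP(m,c)$ for some such index $c$. For a positive integer $z$ let $d(z)$ be the number of positive divisors of $z$, and for a finite set $A$ of primes let $d_A(z)=\prod_{p\notin A}(1+\mathrm{ord}_p z)$, the product being over the primes $p\notin A$, where $p^{\mathrm{ord}_p z}$ is the exact power of $p$ dividing $z$. Then for every positive integer $n$: \begin{enumerate} \item $r_{3,1}(n)=\lfloor (d(2n^2+1)-1)/2 \rfloor$; \item $r_{5,1}(n)=\lfloor (d(6n^2+1)-1)/2 \rfloor$; \item $r_{7,1}(n)=\lfloor (d_{\{3\}}(10n^2+9)-1)/2 \rfloor$; \item $r_{13,1}(n)=\lfloor (d_{\{3\}}(22n^2+81)-1)/2 \rfloor$; \item $r_{31,1}(n)=\lfloor (d_{\{3\}}(58n^2+729)-1)/2 \rfloor$; \item $r_{3,2}(n)=d(n^2+1)/2-1$;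 \item $r_{8,2}(n)=\lfloor (d_{\{2\}}(3n^2+8)-1)/2 \rfloor$; \item $r_{12,2}(n)=\lfloor (d_{\{2\}}(5n^2+32)-1)/2 \rfloor$; \item $r_{24,2}(n)=\lfloor (d_{\{2,5\}}(11n^2+200)-1)/2 \rfloor$; \item $r_{60,2}(n)=\lfloor (d_{\{2,7\}}(29n^2+1568)-1)/2 \rfloor$; \item $r_{3,3}(n)=\lfloor (d_{\{3\}}(2n^2+3)-1)/2 \rfloor$; \item $r_{3,5}(n)=\lfloor (d_{\{5\}}(2n^2+5)-1)/2 \rfloor$; \item $r_{3,11}(n)=\lfloor (d_{\{11\}}(2n^2+11)-1)/2 \rfloor$; \item $r_{3,29}(n)=\lfloor (d_{\{29\}}(2n^2+29)-1)/2 \rfloor$. \end{enumerate} -/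

import Mathlib

/-- The `c`-th `m`-gonal number `P(m, c) = (c / 2) * ((m - 2) * c - (m - 4))`.
The integer division by `2` is exact, see `two_mul_polygonal`. -/
def polygonal (m : ℕ) (c : ℤ) : ℤ :=
  c * (((m : ℤ) - 2) * c - ((m : ℤ) - 4)) / 2

theorem two_mul_polygonal (m : ℕ) (c : ℤ) :
    2 * polygonal m c = c * (((m : ℤ) - 2) * c - ((m : ℤ) - 4)) := by
  unfold polygonal
  apply Int.mul_ediv_cancel'
  rcases Int.even_or_odd' c with ⟨k, rfl | rfl⟩
  · exact ⟨k * (((m : ℤ) - 2) * (2 * k) - ((m : ℤ) - 4)), by ring⟩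
  · exact ⟨(2 * k + 1) * (((m : ℤ) - 2) * k + 1), by ring⟩

/-- The indices of `m`-gonal numbers: positive integers if `m ≤ 4`, all integers if `m > 4`. -/
def IsPolygonalIndex (m : ℕ) (c : ℤ) : Prop :=
  m ≤ 4 → 0 < c

/-- The representations `n = a + b` with `a`, `b` positive integers (the order of the summands
being disregarded, which is normalized by `a ≤ b`) such that `a * b = t * P(m, c)` for some
index `c`. -/
def polygonalReps (m t n : ℕ) : Set (ℕ × ℕ) :=
  {q | 0 < q.1 ∧ q.1 ≤ q.2 ∧ n = q.1 + q.2 ∧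
    ∃ c : ℤ, IsPolygonalIndex m c ∧ (q.1 : ℤ) * (q.2 : ℤ) = (t : ℤ) * polygonal m c}

/-- A set of such representations is finite, so that its `Set.ncard` is its number of elements. -/
theorem polygonalReps_finite (m t n : ℕ) : (polygonalReps m t n).Finite := by
  apply (Set.finite_Iic ((n, n) : ℕ × ℕ)).subset
  rintro ⟨a, b⟩ ⟨_, _, h, _⟩
  simp only at h
  exact Set.mem_Iic.2 (Prod.mk_le_mk.2 ⟨by omega, by omega⟩)

/-- `r_{m,t}(n)`: the number of representations `n = a + b` with `a * b = t * P(m, c)`. -/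
noncomputable def polygonalRepCount (m t n : ℕ) : ℕ :=
  (polygonalReps m t n).ncard

/-- `d_A(z) = ∏_{p ∉ A} (1 + ord_p z)`, for a positive integer `z`. Only the primes `p` that
divide `z` contribute a factor other than `1`. -/
def numDivisorsAway (A : Finset ℕ) (z : ℕ) : ℕ :=
  ∏ p ∈ z.primeFactors \ A, (1 + z.factorization p)

/-! Put `y = b - a`, so `4ab = n ^ 2 - y ^ 2`, and complete the square in `c`. Then `ab = t P(m, c)`
becomes `u x ^ 2 + v y ^ 2 = N` with `N = u s ^ 2 + v n ^ 2` and `x = |l c - σ|`; the known solution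
`(s, n)` is the degenerate decomposition `a = 0`. Conversely, congruences modulo the coefficients
recover `c` from `x` (`polygonalRepCount_add_one`).

It remains to count solutions with `x > 0`. If `N` is coprime to `2uvsn`, then `(x, y) ↦ gcd(xn -
ys, N)` is a bijection onto the divisors of `N` (`ncard_positiveReps_of_coprime`). For `N = de`, the
form restricted to the lattice `d ∣ xn - ys`, `e ∣ xn + ys` is `N` times a form of determinant `uv`.
That form lies in the principal genus, which for `uv = 2, 4, 6, 10, 22, 58` has a single class, so
it represents `1`; this yields a solution, unique up to sign.

Common primes of `N` and `us` are ramified or inert, and are stripped by descent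
(`ncard_positiveReps_eq_numDivisorsAway`); this is why they are omitted in `d_A`. Finally `y ↦ -y`
pairs the solutions, with at most one fixed point, whence the floor. -/

/-- The representations `(x, y)` of `N` by the form `u * x ^ 2 + v * y ^ 2` with `0 < x`. -/
def positiveReps (u v N : ℤ) : Set (ℤ × ℤ) :=
  {q | 0 < q.1 ∧ u * q.1 ^ 2 + v * q.2 ^ 2 = N}

/-! ### Lattices attached to factorizations of `N` -/

/-- The lattice of the `(x, y)` with `d ∣ x * n - y * s` and `e ∣ x * n + y * s`. -/
def splitLattice (s n d e : ℤ) : AddSubgroup (ℤ × ℤ) where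
  carrier := {q | d ∣ q.1 * n - q.2 * s ∧ e ∣ q.1 * n + q.2 * s}
  zero_mem' := by simp
  add_mem' := by
    rintro ⟨a, b⟩ ⟨c, d⟩ ⟨h1, h2⟩ ⟨h3, h4⟩
    refine ⟨(dvd_add h1 h3).trans (dvd_of_eq ?_), (dvd_add h2 h4).trans (dvd_of_eq ?_)⟩ <;>
      simp only [Prod.fst_add, Prod.snd_add] <;> ring
  neg_mem' := by
    rintro ⟨a, b⟩ ⟨h1, h2⟩
    refine ⟨(dvd_neg.2 h1).trans (dvd_of_eq ?_), (dvd_neg.2 h2).trans (dvd_of_eq ?_)⟩ <;>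
      simp only [Prod.fst_neg, Prod.snd_neg] <;> ring

/-- The quadratic form `u * x ^ 2 + v * y ^ 2`. -/
def diagForm (u v : ℤ) (q : ℤ × ℤ) : ℤ := u * q.1 ^ 2 + v * q.2 ^ 2

/-- The bilinear form that belongs to `diagForm`. -/
def diagBilin (u v : ℤ) (q r : ℤ × ℤ) : ℤ := u * q.1 * r.1 + v * q.2 * r.2

theorem diagForm_add (u v : ℤ) (q r : ℤ × ℤ) :
    diagForm u v (q + r) = diagForm u v q + diagForm u v r + 2 * diagBilin u v q r := by
  simp only [diagForm, diagBilin, Prod.fst_add, Prod.snd_add]; ring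

theorem diagForm_sub (u v : ℤ) (q r : ℤ × ℤ) :
    diagForm u v (q - r) = diagForm u v q + diagForm u v r - 2 * diagBilin u v q r := by
  simp only [diagForm, diagBilin, Prod.fst_sub, Prod.snd_sub]; ring

theorem diagForm_mul (u v : ℤ) (q r : ℤ × ℤ) :
    diagForm u v q * diagForm u v r =
      diagBilin u v q r ^ 2 + u * v * (q.1 * r.2 - r.1 * q.2) ^ 2 := by
  simp only [diagForm, diagBilin]; ring

theorem diagForm_nonneg {u v : ℤ} (hu : 0 < u) (hv : 0 < v) (q : ℤ × ℤ) :
    0 ≤ diagForm u v q := by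
  unfold diagForm; positivity

theorem eq_zero_of_diagForm_eq_zero {u v : ℤ} (hu : 0 < u) (hv : 0 < v) {q : ℤ × ℤ}
    (h : diagForm u v q = 0) : q = 0 := by
  unfold diagForm at h
  have h1 : 0 ≤ u * q.1 ^ 2 := by positivity
  have h2 : 0 ≤ v * q.2 ^ 2 := by positivity
  have h3 : u * q.1 ^ 2 = 0 := by linarith
  have h4 : v * q.2 ^ 2 = 0 := by linarith
  ext
  · simpa [hu.ne'] using h3
  · simpa [hv.ne'] using h4

/-- Modulo `de`, `n ^ 2` times the form is `u (xn - ys)(xn + ys)`, and `n` is invertible. -/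
theorem dvd_diagForm_of_mem {u v s n d e : ℤ} (hde : d * e = u * s ^ 2 + v * n ^ 2)
    (hn : IsCoprime (d * e) n) {q : ℤ × ℤ} (hq : q ∈ splitLattice s n d e) :
    d * e ∣ diagForm u v q := by
  obtain ⟨⟨A, hA⟩, ⟨B, hB⟩⟩ := hq
  have key : n ^ 2 * diagForm u v q = d * e * (u * A * B + q.2 ^ 2) := by
    unfold diagForm
    linear_combination u * (q.1 * n + q.2 * s) * hA + u * d * A * hB - q.2 ^ 2 * hde
  exact (hn.pow_right (n := 2)).dvd_of_dvd_mul_left ⟨_, key⟩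

theorem dvd_diagBilin_of_mem {u v s n d e : ℤ} (hde : d * e = u * s ^ 2 + v * n ^ 2)
    (hn : IsCoprime (d * e) n) (h2 : IsCoprime (d * e) 2) {q r : ℤ × ℤ}
    (hq : q ∈ splitLattice s n d e) (hr : r ∈ splitLattice s n d e) :
    d * e ∣ diagBilin u v q r := by
  refine h2.dvd_of_dvd_mul_left ?_
  have h := diagForm_add u v q r
  have h1 := dvd_diagForm_of_mem hde hn (add_mem hq hr)
  have h2 := dvd_add (dvd_diagForm_of_mem hde hn hq) (dvd_diagForm_of_mem hde hn hr)
  rw [h] at h1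
  exact (dvd_add_right h2).1 h1

theorem exists_splitLattice_basis {s n d e : ℤ} (hd : 0 < d) (hn : IsCoprime (d * e) n) :
    ∃ q ∈ splitLattice s n d e, ∃ r ∈ splitLattice s n d e, q.1 * r.2 - r.1 * q.2 = d * e := by
  have hg : 0 < Int.gcd d e := Int.gcd_pos_of_ne_zero_left _ hd.ne'
  obtain ⟨d', e', hco, hd', he'⟩ := Int.exists_gcd_one hg
  generalize (Int.gcd d e : ℤ) = g at hd' he'
  obtain ⟨a, b, hab⟩ := Int.isCoprime_iff_gcd_eq_one.2 hco
  obtain ⟨i, j, hij⟩ := hn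
  subst hd' he'
  -- Chinese remainder theorem: `j` inverts `n`, and `b e' - a d'` is `1` modulo `d'` and `-1`
  -- modulo `e'`.
  refine ⟨(g * d' * e', 0), ⟨⟨e' * n, by ring⟩, ⟨d' * n, by ring⟩⟩,
    (g * (j * s * (b * e' - a * d')), g), ⟨?_, ?_⟩, by ring⟩
  · refine ⟨-(2 * a * j * n * s) - s * i * g * g * e', ?_⟩
    linear_combination (g * s * j * n) * hab + g * s * hij
  · refine ⟨2 * b * j * n * s + s * i * g * g * d', ?_⟩
    linear_combination (-g * s * j * n) * hab - g * s * hij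

theorem exists_splitLattice_reduced_basis {u v s n d e : ℤ} (hu : 0 < u) (hv : 0 < v) (hd : 0 < d)
    (hn : IsCoprime (d * e) n) :
    ∃ q ∈ splitLattice s n d e, ∃ r ∈ splitLattice s n d e, q.1 * r.2 - r.1 * q.2 = d * e ∧
      2 * |diagBilin u v q r| ≤ diagForm u v q ∧ 2 * |diagBilin u v q r| ≤ diagForm u v r := by
  let T : Set ((ℤ × ℤ) × (ℤ × ℤ)) := {p | p.1 ∈ splitLattice s n d e ∧
    p.2 ∈ splitLattice s n d e ∧ p.1.1 * p.2.2 - p.2.1 * p.1.2 = d * e}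
  have hT : T.Nonempty := by
    obtain ⟨q, hq, r, hr, h⟩ := exists_splitLattice_basis (s := s) hd hn
    exact ⟨(q, r), hq, hr, h⟩
  -- Gauss reduction by minimality: no replacement of `r` by `r ± q` or of `q` by `q ± r` lowers the
  -- sum of the two values.
  obtain ⟨⟨q, r⟩, ⟨hq, hr, hdet⟩, hmin⟩ := (measure fun p : (ℤ × ℤ) × (ℤ × ℤ) =>
    (diagForm u v p.1 + diagForm u v p.2).toNat).wf.has_min T hT
  have hle : ∀ q' ∈ splitLattice s n d e, ∀ r' ∈ splitLattice s n d e,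
      q'.1 * r'.2 - r'.1 * q'.2 = d * e →
      diagForm u v q + diagForm u v r ≤ diagForm u v q' + diagForm u v r' := by
    intro q' hq' r' hr' h
    have h1 : ¬ (diagForm u v q' + diagForm u v r').toNat <
      (diagForm u v q + diagForm u v r).toNat := hmin (q', r') ⟨hq', hr', h⟩
    have := diagForm_nonneg hu hv q'
    have := diagForm_nonneg hu hv r'
    omega
  refine ⟨q, hq, r, hr, hdet, ?_⟩
  simp only at hdet
  have h1 := hle q hq (r + q) (add_mem hr hq) (by simp only [Prod.fst_add, Prod.snd_add]; linarith)
  have h2 := hle q hq (r - q) (sub_mem hr hq) (by simp only [Prod.fst_sub, Prod.snd_sub]; linarith)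
  have h3 := hle (q + r) (add_mem hq hr) r hr (by simp only [Prod.fst_add, Prod.snd_add]; linarith)
  have h4 := hle (q - r) (sub_mem hq hr) r hr (by simp only [Prod.fst_sub, Prod.snd_sub]; linarith)
  have hc : diagBilin u v r q = diagBilin u v q r := by unfold diagBilin; ring
  rw [diagForm_add] at h1 h3
  rw [diagForm_sub] at h2 h4
  constructor <;> rcases abs_cases (diagBilin u v q r) with h | h <;> linarith

/-- Every form of determinant `k` that is reduced in the sense of Gauss is either principal
or does not belong to the principal genus. -/
def OneClassInPrincipalGenus (k : ℤ) : Prop :=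
  ∀ a b c : ℤ, 0 < a → a ≤ c → 2 * |b| ≤ a → a * c - b ^ 2 = k →
    a = 1 ∨ ∀ B D N : ℤ, IsCoprime N (2 * k) → B ^ 2 + k * D ^ 2 ≠ a * N ^ 2

/-- Dividing the Gram matrix of a reduced pair by `N = de` gives a reduced form of determinant `uv`.
Composing with `(s, n)` shows that the principal form represents `N ^ 2` times each of its diagonal
coefficients, so the smaller one is `1`. -/
theorem exists_mem_splitLattice_diagForm_eq {u v s n d e : ℤ} (hu : 0 < u) (hv : 0 < v)
    (hd : 0 < d) (he : 0 < e) (hde : d * e = u * s ^ 2 + v * n ^ 2) (hn : IsCoprime (d * e) n)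
    (hk : IsCoprime (d * e) (2 * (u * v))) (hcl : OneClassInPrincipalGenus (u * v)) :
    ∃ q ∈ splitLattice s n d e, diagForm u v q = d * e := by
  obtain ⟨q, hq, r, hr, hdet, h1, h2⟩ :=
    exists_splitLattice_reduced_basis (s := s) hu hv hd hn
  have hN : 0 < d * e := mul_pos hd he
  have hk2 : IsCoprime (d * e) 2 := hk.of_mul_right_left
  obtain ⟨a, ha⟩ := dvd_diagForm_of_mem hde hn hq
  obtain ⟨c, hc⟩ := dvd_diagForm_of_mem hde hn hr
  obtain ⟨b, hb⟩ := dvd_diagBilin_of_mem hde hn hk2 hq hr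
  have hmul := diagForm_mul u v q r
  rw [hdet, ha, hc, hb] at hmul
  have hk : a * c - b ^ 2 = u * v :=
    mul_left_cancel₀ (pow_ne_zero 2 hN.ne') (by linear_combination hmul)
  rw [ha, hb, abs_mul, abs_of_pos hN] at h1
  rw [hc, hb, abs_mul, abs_of_pos hN] at h2
  replace h1 : 2 * |b| ≤ a := le_of_mul_le_mul_left (by linarith) hN
  replace h2 : 2 * |b| ≤ c := le_of_mul_le_mul_left (by linarith) hN
  have huv : 0 < u * v := mul_pos hu hv
  have hb0 := abs_nonneg b
  have hac : 0 < a * c := by nlinarith [sq_nonneg b]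
  have ha0 : 0 < a := by nlinarith
  have hc0 : 0 < c := by nlinarith
  have key : ∀ w : ℤ, ∀ q ∈ splitLattice s n d e, diagForm u v q = d * e * w →
      (w = 1 ∨ ∀ B D N : ℤ, IsCoprime N (2 * (u * v)) → B ^ 2 + u * v * D ^ 2 ≠ w * N ^ 2) →
      ∃ q ∈ splitLattice s n d e, diagForm u v q = d * e := by
    rintro w q hq hw (rfl | h)
    · exact ⟨q, hq, by simpa using hw⟩
    · exfalso
      have hm := diagForm_mul u v (s, n) q
      rw [hw, show diagForm u v (s, n) = d * e from hde.symm] at hm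
      exact h _ _ (d * e) ‹_› (by rw [← hm]; ring)
  rcases le_total a c with h | h
  · exact key a q hq ha (hcl a b c ha0 h h1 hk)
  · exact key c r hr hc (hcl c b a hc0 h h2 (by linarith))

/-- The bilinear value is `N b` with `b ^ 2 ≤ 1` by Cauchy–Schwarz. If `b = ±1` the vectors agree up
to sign; `b = 0` would give `v ∣ N ^ 2`, impossible for `v > 1` prime to `N`. -/
theorem eq_or_eq_neg_of_mem_splitLattice {u v s n d e : ℤ} (hu : 0 < u) (hv : 1 < v)
    (hd : 0 < d) (he : 0 < e) (hde : d * e = u * s ^ 2 + v * n ^ 2) (hn : IsCoprime (d * e) n)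
    (hk : IsCoprime (d * e) (2 * (u * v))) {q r : ℤ × ℤ} (hq : q ∈ splitLattice s n d e)
    (hr : r ∈ splitLattice s n d e) (hqN : diagForm u v q = d * e)
    (hrN : diagForm u v r = d * e) : q = r ∨ q = -r := by
  have hN : 0 < d * e := mul_pos hd he
  obtain ⟨b, hb⟩ := dvd_diagBilin_of_mem hde hn hk.of_mul_right_left hq hr
  have hmul := diagForm_mul u v q r
  rw [hqN, hrN, hb] at hmul
  set D := q.1 * r.2 - r.1 * q.2
  have hv0 : 0 < v := by linarith
  have hb1 : b ^ 2 ≤ 1 := by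
    refine le_of_mul_le_mul_left (a := (d * e) ^ 2) ?_ (by positivity)
    have : 0 ≤ u * v * D ^ 2 := by positivity
    linarith
  have hb2 : -1 ≤ b ∧ b ≤ 1 := abs_le.1 (by rwa [← sq_le_one_iff_abs_le_one])
  obtain hb | rfl | hb' : b = -1 ∨ b = 0 ∨ b = 1 := by omega
  · right
    have := diagForm_add u v q r
    rw [hqN, hrN] at this
    exact eq_neg_of_add_eq_zero_left (eq_zero_of_diagForm_eq_zero hu hv0 (by
      rw [this]; subst hb; linarith))
  · exfalso
    have h1 : v ∣ (d * e) ^ 2 := ⟨u * D ^ 2, by linear_combination hmul⟩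
    have h2 : IsCoprime ((d * e) ^ 2) v := hk.of_mul_right_right.of_mul_right_right.pow_left
    have h3 := h2.isUnit_of_dvd' h1 dvd_rfl
    rcases Int.isUnit_iff.1 h3 with h | h <;> omega
  · left
    have := diagForm_sub u v q r
    rw [hqN, hrN] at this
    exact sub_eq_zero.1 (eq_zero_of_diagForm_eq_zero hu hv0 (by
      rw [this]; subst hb'; linarith))

/-! ### Representations and divisors in the coprime case -/

theorem gcd_mul_gcd_eq {u v s n x y N : ℤ} (hN0 : 0 < N) (hN : N = u * s ^ 2 + v * n ^ 2)
    (hu : IsCoprime N u) (hn : IsCoprime N n) (hs : IsCoprime N s) (h2 : IsCoprime N 2)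
    (hxy : u * x ^ 2 + v * y ^ 2 = N) :
    (Int.gcd (x * n - y * s) N : ℤ) * Int.gcd (x * n + y * s) N = N := by
  set d : ℤ := ((Int.gcd (x * n - y * s) N : ℕ) : ℤ) with hd
  set e : ℤ := ((Int.gcd (x * n + y * s) N : ℕ) : ℤ) with he
  have hdN : d ∣ N := Int.gcd_dvd_right ..
  have heN : e ∣ N := Int.gcd_dvd_right ..
  have hdD : d ∣ x * n - y * s := Int.gcd_dvd_left ..
  have heD : e ∣ x * n + y * s := Int.gcd_dvd_left ..
  refine Int.dvd_antisymm (by positivity) hN0.le ?_ ?_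
  · have hdB : d ∣ u * x * s + v * y * n := by
      refine (hn.of_isCoprime_of_dvd_left hdN).dvd_of_dvd_mul_left ?_
      refine (dvd_add (hdD.mul_left (u * s)) (hdN.mul_left y)).trans (dvd_of_eq ?_)
      rw [hN]; ring
    have heB : e ∣ u * x * s - v * y * n := by
      refine (hn.of_isCoprime_of_dvd_left heN).dvd_of_dvd_mul_left ?_
      refine (dvd_sub (heD.mul_left (u * s)) (heN.mul_left y)).trans (dvd_of_eq ?_)
      rw [hN]; ring
    -- The sum of the two products is `2sn (u x ^ 2 + v y ^ 2)`.
    have h : d * e ∣ (2 * s * n) * N := by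
      refine (dvd_add (mul_dvd_mul hdB heD) (mul_dvd_mul hdD heB)).trans (dvd_of_eq ?_)
      rw [← hxy]; ring
    have hc : IsCoprime N (2 * s * n) := (h2.mul_right hs).mul_right hn
    exact ((hc.of_isCoprime_of_dvd_left hdN).mul_left
      (hc.of_isCoprime_of_dvd_left heN)).dvd_of_dvd_mul_left h
  · have h : N ∣ (x * n - y * s) * (x * n + y * s) := by
      refine hu.dvd_of_dvd_mul_left ⟨n ^ 2 - y ^ 2, ?_⟩
      linear_combination y ^ 2 * hN + n ^ 2 * hxy
    rw [hd, Int.gcd_eq_gcd_ab, he, Int.gcd_eq_gcd_ab]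
    have e1 : ∀ a b c d p q : ℤ, (p * a + N * b) * (q * c + N * d) =
      p * q * (a * c) + N * (b * q * c + p * a * d + N * b * d) := fun _ _ _ _ _ _ => by ring
    rw [e1]
    exact dvd_add (h.mul_right _) (dvd_mul_right _ _)

theorem positiveReps_finite {u v : ℤ} (hu : 0 < u) (hv : 0 < v) (N : ℤ) :
    (positiveReps u v N).Finite := by
  apply (Set.finite_Icc ((-N, -N) : ℤ × ℤ) (N, N)).subset
  rintro ⟨x, y⟩ ⟨-, h⟩
  simp only at h
  have h1 : x ^ 2 ≤ u * x ^ 2 := by nlinarith [sq_nonneg x]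
  have h2 : y ^ 2 ≤ v * y ^ 2 := by nlinarith [sq_nonneg y]
  have h3 := Int.natAbs_le_self_sq x
  have h4 := Int.natAbs_le_self_sq y
  have := sq_nonneg x
  have := sq_nonneg y
  constructor <;> constructor <;> simp only <;> omega

theorem ncard_positiveReps_of_coprime {u v s n : ℤ} {N : ℕ} (hu : 0 < u) (hv : 1 < v)
    (hN0 : 0 < N) (hN : (N : ℤ) = u * s ^ 2 + v * n ^ 2) (hn : IsCoprime (N : ℤ) n)
    (hs : IsCoprime (N : ℤ) s) (hk : IsCoprime (N : ℤ) (2 * (u * v)))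
    (hcl : OneClassInPrincipalGenus (u * v)) :
    (positiveReps u v N).ncard = N.divisors.card := by
  have hv0 : 0 < v := by linarith
  have hNz : (0 : ℤ) < N := by exact_mod_cast hN0
  have hprod : ∀ q ∈ positiveReps u v N,
      (Int.gcd (q.1 * n - q.2 * s) N : ℤ) * Int.gcd (q.1 * n + q.2 * s) N = N := fun q hq =>
    gcd_mul_gcd_eq hNz hN hk.of_mul_right_right.of_mul_right_left hn hs
      hk.of_mul_right_left hq.2
  have hmem : ∀ q ∈ positiveReps u v N, q ∈ splitLattice s n (Int.gcd (q.1 * n - q.2 * s) N)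
      (Int.gcd (q.1 * n + q.2 * s) N) := fun q _ =>
    ⟨Int.gcd_dvd_left .., Int.gcd_dvd_left ..⟩
  rw [← Set.ncard_coe_finset]
  refine Set.BijOn.ncard_eq (f := fun q : ℤ × ℤ => Int.gcd (q.1 * n - q.2 * s) N) ⟨?_, ?_, ?_⟩
  · intro q hq
    simp only [Finset.mem_coe, Nat.mem_divisors]
    exact ⟨by exact_mod_cast Int.gcd_dvd_right (q.1 * n - q.2 * s) (N : ℤ), hN0.ne'⟩
  · intro q hq r hr hqr
    simp only at hqr
    have hd0 : (0 : ℤ) < Int.gcd (q.1 * n - q.2 * s) N := by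
      exact_mod_cast Int.gcd_pos_of_ne_zero_right _ hNz.ne'
    have he0 : (0 : ℤ) < Int.gcd (q.1 * n + q.2 * s) N := by
      exact_mod_cast Int.gcd_pos_of_ne_zero_right _ hNz.ne'
    have hpq := hprod q hq
    have hpr := hprod r hr
    have hmr := hmem r hr
    rw [← hqr] at hpr hmr
    rw [mul_left_cancel₀ hd0.ne' (hpr.trans hpq.symm)] at hmr
    rcases eq_or_eq_neg_of_mem_splitLattice hu hv hd0 he0 (hpq.trans hN) (by rwa [hpq])
      (by rwa [hpq]) (hmem q hq) hmr (by rw [hpq]; exact hq.2) (by rw [hpq]; exact hr.2) with h | h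
    · exact h
    · have h1 := hq.1
      have h2 := hr.1
      rw [h, Prod.fst_neg] at h1
      linarith
  · intro d hd
    simp only [Finset.mem_coe, Nat.mem_divisors] at hd
    obtain ⟨⟨e, he⟩, -⟩ := hd
    have hd0 : 0 < d := by rcases Nat.eq_zero_or_pos d with h | h <;> simp_all
    have he0 : 0 < e := by rcases Nat.eq_zero_or_pos e with h | h <;> simp_all
    have hdeN : (d : ℤ) * e = N := by rw [he]; push_cast; ring
    obtain ⟨q, hq, hqN⟩ := exists_mem_splitLattice_diagForm_eq (s := s) (n := n) (d := d) (e := e)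
      hu hv0 (by exact_mod_cast hd0) (by exact_mod_cast he0) (by rw [hdeN, hN])
      (by rwa [hdeN]) (by rwa [hdeN]) hcl
    rw [hdeN] at hqN
    -- If `x = 0`, then `v > 1` would divide `N`, to which it is coprime. So exactly one of `±q` has
    -- positive first coordinate.
    have hx : q.1 ≠ 0 := by
      intro h
      have h1 : v ∣ N := ⟨q.2 ^ 2, by rw [← hqN, diagForm, h]; ring⟩
      have h3 := hk.of_mul_right_right.of_mul_right_right.isUnit_of_dvd' h1 dvd_rfl
      rcases Int.isUnit_iff.1 h3 with h | h <;> omega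
    obtain ⟨r, hr, hr0, hrN⟩ : ∃ r ∈ splitLattice s n d e, 0 < r.1 ∧ diagForm u v r = N := by
      rcases hx.lt_or_gt with h | h
      · exact ⟨-q, neg_mem hq, by simpa using h, by rw [← hqN]; simp [diagForm]⟩
      · exact ⟨q, hq, h, hqN⟩
    have hrS : r ∈ positiveReps u v N := ⟨hr0, hrN⟩
    refine ⟨r, hrS, ?_⟩
    have hp := hprod r hrS
    have h1 : (d : ℤ) ∣ Int.gcd (r.1 * n - r.2 * s) N :=
      Int.dvd_coe_gcd hr.1 ⟨e, hdeN.symm⟩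
    have h2 : (e : ℤ) ∣ Int.gcd (r.1 * n + r.2 * s) N :=
      Int.dvd_coe_gcd hr.2 ⟨d, by rw [← hdeN, mul_comm]⟩
    norm_cast at h1 h2 hp hdeN
    simp only
    obtain ⟨i, hi⟩ := h1
    obtain ⟨j, hj⟩ := h2
    rw [hi, hj, ← hdeN] at hp
    -- `d` and `e` divide the two gcds, whose product is also `de`, so both divisibilities are
    -- equalities.
    have : i * j = 1 := by
      have h0 : 0 < d * e := Nat.mul_pos hd0 he0
      exact Nat.eq_of_mul_eq_mul_left h0 (by linarith)
    rw [hi, Nat.eq_one_of_mul_eq_one_right this, mul_one]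

/-! ### Removing ramified and inert primes -/

theorem numDivisorsAway_prime_mul {A : Finset ℕ} {q N : ℕ} (hq : q.Prime) (hqA : q ∈ A)
    (hN : N ≠ 0) : numDivisorsAway A (q * N) = numDivisorsAway A N := by
  unfold numDivisorsAway
  have h : (q * N).primeFactors \ A = N.primeFactors \ A := by
    ext p
    simp only [Finset.mem_sdiff, Nat.primeFactors_mul hq.ne_zero hN, hq.primeFactors,
      Finset.mem_union, Finset.mem_singleton]
    constructor
    · rintro ⟨rfl | h, h'⟩
      · exact absurd hqA h'
      · exact ⟨h, h'⟩
    · rintro ⟨h, h'⟩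
      exact ⟨Or.inr h, h'⟩
  rw [h]
  refine Finset.prod_congr rfl fun p hp => ?_
  have hpq : q ≠ p := fun h => (Finset.mem_sdiff.1 hp).2 (h ▸ hqA)
  rw [Nat.factorization_mul hq.ne_zero hN, Finsupp.add_apply, hq.factorization,
    Finsupp.single_eq_of_ne' hpq, zero_add]

theorem numDivisorsAway_eq_card_divisors {A : Finset ℕ} {N : ℕ} (hN : N ≠ 0)
    (h : ∀ q ∈ A, ¬ q ∣ N) : numDivisorsAway A N = N.divisors.card := by
  unfold numDivisorsAway
  rw [Nat.card_divisors hN, Finset.sdiff_eq_self_of_disjoint]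
  · exact Finset.prod_congr rfl fun p _ => add_comm _ _
  · rw [Finset.disjoint_left]
    exact fun p hp hpA => h p hpA (Nat.dvd_of_mem_primeFactors hp)

/-- A ramified prime dividing `u` but not `v` must divide `y`; cancelling it moves it to the other
coefficient. -/
theorem ncard_positiveReps_mul_left {q : ℕ} (hq : q.Prime) {u v : ℤ} (hv : ¬ (q : ℤ) ∣ v)
    (N : ℤ) : (positiveReps (q * u) v (q * N)).ncard = (positiveReps u (q * v) N).ncard := by
  have hq0 : (q : ℤ) ≠ 0 := by exact_mod_cast hq.ne_zero
  symm
  refine Set.BijOn.ncard_eq (f := fun p : ℤ × ℤ => (p.1, q * p.2)) ⟨?_, ?_, ?_⟩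
  · rintro ⟨x, y⟩ ⟨h1, h2⟩
    exact ⟨h1, by simp only at h2 ⊢; rw [← h2]; ring⟩
  · rintro ⟨x, y⟩ _ ⟨x', y'⟩ _ h
    simpa [hq.ne_zero] using h
  · rintro ⟨x, y⟩ ⟨h1, h2⟩
    simp only at h1 h2
    have h3 : (q : ℤ) ∣ v * y ^ 2 := ⟨N - u * x ^ 2, by linear_combination h2⟩
    have hqp := Nat.prime_iff_prime_int.1 hq
    obtain ⟨y', rfl⟩ := hqp.dvd_of_dvd_pow ((hqp.dvd_or_dvd h3).resolve_left hv)
    exact ⟨(x, y'), ⟨h1, mul_left_cancel₀ hq0 (by simp only; linear_combination h2)⟩, rfl⟩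

theorem ncard_positiveReps_mul_right {q : ℕ} (hq : q.Prime) {u v : ℤ} (hu : ¬ (q : ℤ) ∣ u)
    (N : ℤ) : (positiveReps u (q * v) (q * N)).ncard = (positiveReps (q * u) v N).ncard := by
  have hq0 : (0 : ℤ) < q := by exact_mod_cast hq.pos
  symm
  refine Set.BijOn.ncard_eq (f := fun p : ℤ × ℤ => (q * p.1, p.2)) ⟨?_, ?_, ?_⟩
  · rintro ⟨x, y⟩ ⟨h1, h2⟩
    exact ⟨mul_pos hq0 h1, by simp only at h2 ⊢; rw [← h2]; ring⟩
  · rintro ⟨x, y⟩ _ ⟨x', y'⟩ _ h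
    simpa [hq.ne_zero] using h
  · rintro ⟨x, y⟩ ⟨h1, h2⟩
    simp only at h1 h2
    have h3 : (q : ℤ) ∣ u * x ^ 2 := ⟨N - v * y ^ 2, by linear_combination h2⟩
    have hqp := Nat.prime_iff_prime_int.1 hq
    obtain ⟨x', rfl⟩ := hqp.dvd_of_dvd_pow ((hqp.dvd_or_dvd h3).resolve_left hu)
    exact ⟨(x', y), ⟨pos_of_mul_pos_right h1 hq0.le,
      mul_left_cancel₀ hq0.ne' (by simp only; linear_combination h2)⟩, rfl⟩

theorem ncard_positiveReps_sq_mul {q : ℕ} (hq : 0 < q) {u v : ℤ}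
    (h : ∀ x y : ℤ, (q : ℤ) ∣ u * x ^ 2 + v * y ^ 2 → (q : ℤ) ∣ x ∧ (q : ℤ) ∣ y) (N : ℤ) :
    (positiveReps u v (q * (q * N))).ncard = (positiveReps u v N).ncard := by
  have hq0 : (0 : ℤ) < q := by exact_mod_cast hq
  symm
  refine Set.BijOn.ncard_eq (f := fun p : ℤ × ℤ => (q * p.1, q * p.2)) ⟨?_, ?_, ?_⟩
  · rintro ⟨x, y⟩ ⟨h1, h2⟩
    exact ⟨mul_pos hq0 h1, by simp only at h2 ⊢; rw [← h2]; ring⟩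
  · rintro ⟨x, y⟩ _ ⟨x', y'⟩ _ h
    simpa [hq.ne'] using h
  · rintro ⟨x, y⟩ ⟨h1, h2⟩
    simp only at h1 h2
    obtain ⟨⟨x', rfl⟩, y', rfl⟩ := h x y ⟨_, h2⟩
    exact ⟨(x', y'), ⟨pos_of_mul_pos_right h1 hq0.le,
      mul_left_cancel₀ hq0.ne' (mul_left_cancel₀ hq0.ne' (by
        simp only; linear_combination h2))⟩, rfl⟩

/-- The prime `q` is inert for the norm form `x ^ 2 + k * y ^ 2`. -/
def IsInertFor (q : ℕ) (k : ℤ) : Prop :=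
  ∀ x y : ℤ, (q : ℤ) ∣ x ^ 2 + k * y ^ 2 → (q : ℤ) ∣ x ∧ (q : ℤ) ∣ y

theorem IsInertFor.dvd_and_dvd {q : ℕ} (hq : q.Prime) {u v : ℤ} (h : IsInertFor q (u * v))
    {x y : ℤ} (hxy : (q : ℤ) ∣ u * x ^ 2 + v * y ^ 2) : (q : ℤ) ∣ x ∧ (q : ℤ) ∣ y := by
  have hqp := Nat.prime_iff_prime_int.1 hq
  have hu : ¬ (q : ℤ) ∣ u := fun hu => hqp.not_dvd_one
    (h 0 1 (by simpa using hu.mul_right v)).2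
  obtain ⟨h1, h2⟩ := h (u * x) y ((hxy.mul_left u).trans (dvd_of_eq (by ring)))
  exact ⟨(hqp.dvd_or_dvd h1).resolve_left hu, h2⟩

theorem Int.isCoprime_of_forall_prime {a b : ℤ}
    (h : ∀ p : ℕ, p.Prime → (p : ℤ) ∣ a → ¬ (p : ℤ) ∣ b) : IsCoprime a b := by
  rw [Int.isCoprime_iff_gcd_eq_one]
  by_contra hg
  obtain ⟨p, hp, hpg⟩ := Nat.exists_prime_and_dvd hg
  have hpg' : (p : ℤ) ∣ (Int.gcd a b : ℕ) := by exact_mod_cast hpg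
  exact h p hp (hpg'.trans (Int.gcd_dvd_left ..)) (hpg'.trans (Int.gcd_dvd_right ..))

/-- If `N` is represented by the form `u * x ^ 2 + v * y ^ 2`, with one class in its principal
genus, and if all primes in the first term of that representation belong to a set `A` of inert
and ramified primes, then the number of representations is the number of divisors away from
`A`. -/
theorem ncard_positiveReps_eq_numDivisorsAway {A : Finset ℕ} (hA : ∀ q ∈ A, q.Prime) {k : ℤ}
    (hk2 : 2 ∣ k) (hcl : OneClassInPrincipalGenus k) {p : ℕ} (hp : p.Prime) (hpk : (p : ℤ) ∣ k)
    (hpA : p ∉ A)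
    (hAk : ∀ q ∈ A, ((q : ℤ) ∣ k ∧ ¬ (q : ℤ) * q ∣ k) ∨ IsInertFor q k) (N : ℕ) (hN0 : 0 < N)
    (u v s n : ℤ) (hu : 0 < u) (hv : 0 < v) (huv : u * v = k)
    (hus : ∀ l : ℕ, l.Prime → (l : ℤ) ∣ u * s → l ∈ A) (hN : (N : ℤ) = u * s ^ 2 + v * n ^ 2) :
    (positiveReps u v N).ncard = numDivisorsAway A N := by
  induction N using Nat.strong_induction_on generalizing u v s n with
  | _ N ih =>
  by_cases hex : ∃ q ∈ A, q ∣ N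
  · obtain ⟨q, hqA, M, rfl⟩ := hex
    have hq := hA q hqA
    have hqp := Nat.prime_iff_prime_int.1 hq
    have hq0 : (q : ℤ) ≠ 0 := hqp.ne_zero
    have hM0 : 0 < M := Nat.pos_of_mul_pos_left hN0
    have hqz : (0 : ℤ) < q := by exact_mod_cast hq.pos
    have hMlt : M < q * M := by nlinarith [hq.two_le]
    rw [numDivisorsAway_prime_mul hq hqA hM0.ne']
    push_cast at hN ⊢
    have hql : ∀ l : ℕ, l.Prime → (l : ℤ) ∣ q → l ∈ A := fun l hl h => by
      rw [(Nat.prime_dvd_prime_iff_eq hl hq).1 (by exact_mod_cast h)]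
      exact hqA
    rcases hAk q hqA with ⟨hqk, hqk2⟩ | hin
    · rw [← huv] at hqk hqk2
      rcases hqp.dvd_or_dvd hqk with ⟨u', rfl⟩ | ⟨v', rfl⟩
      · have hqv : ¬ (q : ℤ) ∣ v := fun ⟨w, hw⟩ => hqk2 ⟨u' * w, by rw [hw]; ring⟩
        have hqn : (q : ℤ) ∣ n := by
          have h : (q : ℤ) ∣ v * n ^ 2 := ⟨M - u' * s ^ 2, by linear_combination -hN⟩
          exact hqp.dvd_of_dvd_pow ((hqp.dvd_or_dvd h).resolve_left hqv)
        obtain ⟨n', rfl⟩ := hqn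
        rw [ncard_positiveReps_mul_left hq hqv]
        refine ih M hMlt hM0 u' (q * v) s n' (pos_of_mul_pos_right hu hqz.le)
          (mul_pos hqz hv) (by rw [← huv]; ring)
          (fun l hl h => hus l hl (by rw [mul_assoc]; exact h.mul_left _))
          (mul_left_cancel₀ hq0 (by linear_combination hN))
      · have hqu : ¬ (q : ℤ) ∣ u := fun ⟨w, hw⟩ => hqk2 ⟨w * v', by rw [hw]; ring⟩
        have hqs : (q : ℤ) ∣ s := by
          have h : (q : ℤ) ∣ u * s ^ 2 := ⟨M - v' * n ^ 2, by linear_combination -hN⟩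
          exact hqp.dvd_of_dvd_pow ((hqp.dvd_or_dvd h).resolve_left hqu)
        obtain ⟨s', rfl⟩ := hqs
        rw [ncard_positiveReps_mul_right hq hqu]
        exact ih M hMlt hM0 (q * u) v' s' n (mul_pos hqz hu)
          (pos_of_mul_pos_right hv hqz.le) (by rw [← huv]; ring)
          (fun l hl h => hus l hl (h.trans (dvd_of_eq (by ring))))
          (mul_left_cancel₀ hq0 (by linear_combination hN))
    · rw [← huv] at hin
      have hdvd := fun x y => IsInertFor.dvd_and_dvd hq hin (x := x) (y := y)
      obtain ⟨⟨s', rfl⟩, n', rfl⟩ := hdvd s n ⟨_, hN.symm⟩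
      have hM : (M : ℤ) = q * (u * s' ^ 2 + v * n' ^ 2) :=
        mul_left_cancel₀ hq0 (by linear_combination hN)
      obtain ⟨L, rfl⟩ : q ∣ M := by exact_mod_cast Dvd.intro _ hM.symm
      have hL0 : 0 < L := Nat.pos_of_mul_pos_left hM0
      rw [numDivisorsAway_prime_mul hq hqA hL0.ne']
      push_cast at hM ⊢
      rw [ncard_positiveReps_sq_mul hq.pos hdvd]
      exact ih L (by nlinarith [hq.two_le]) hL0 u v s' n' hu hv huv
        (fun l hl h => hus l hl (h.trans ⟨q, by ring⟩)) (mul_left_cancel₀ hq0 hM)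
  · push Not at hex
    rw [numDivisorsAway_eq_card_divisors hN0.ne' hex]
    -- With no prime of `A` left in `N`, `hus` makes `N` coprime to `us`; since `N = u s ^ 2 + v n ^
    -- 2`, it is then coprime to `v n` too.
    have hlA : ∀ l : ℕ, l.Prime → (l : ℤ) ∣ N → ¬ (l : ℤ) ∣ u ∧ ¬ (l : ℤ) ∣ s :=
      fun l hl hlN => ⟨fun h => hex l (hus l hl (h.mul_right s)) (by exact_mod_cast hlN),
        fun h => hex l (hus l hl (h.mul_left u)) (by exact_mod_cast hlN)⟩
    have hlus : ∀ l : ℕ, l.Prime → (l : ℤ) ∣ N → ¬ (l : ℤ) ∣ v * n ^ 2 := fun l hl hlN h => by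
      have h1 : (l : ℤ) ∣ u * s ^ 2 := (dvd_add_left h).1 (hN ▸ hlN)
      have hlp := Nat.prime_iff_prime_int.1 hl
      rcases hlp.dvd_or_dvd h1 with h2 | h2
      · exact (hlA l hl hlN).1 h2
      · exact (hlA l hl hlN).2 (hlp.dvd_of_dvd_pow h2)
    have hlk : ∀ l : ℕ, l.Prime → (l : ℤ) ∣ N → ¬ (l : ℤ) ∣ u * v := fun l hl hlN h =>
      ((Nat.prime_iff_prime_int.1 hl).dvd_or_dvd h).elim (hlA l hl hlN).1
        fun h => hlus l hl hlN (h.mul_right _)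
    refine ncard_positiveReps_of_coprime hu ?_ hN0 hN
      (Int.isCoprime_of_forall_prime fun l hl hlN h =>
        hlus l hl hlN ((h.pow two_ne_zero).mul_left v))
      (Int.isCoprime_of_forall_prime fun l hl hlN => (hlA l hl hlN).2)
      (Int.isCoprime_of_forall_prime fun l hl hlN h => ?_) (huv ▸ hcl)
    -- `p` cannot divide `u`, all of whose primes lie in `A`; so `p ∣ v` and `v > 1`.
    · rw [← huv] at hpk
      have hpv := ((Nat.prime_iff_prime_int.1 hp).dvd_or_dvd hpk).resolve_left
        fun h => hpA (hus p hp (h.mul_right s))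
      have := Int.le_of_dvd hv hpv
      have := hp.two_le
      omega
    · rcases (Nat.prime_iff_prime_int.1 hl).dvd_or_dvd h with h | h
      · exact hlk l hl hlN (h.trans (huv ▸ hk2))
      · exact hlk l hl hlN h

/-! ### From decompositions of `n` to representations of `N` -/

theorem ncard_add_ncard_eq_two_mul {S : Set (ℤ × ℤ)} (hS : S.Finite)
    (hneg : ∀ q ∈ S, (q.1, -q.2) ∈ S) :
    S.ncard + {q ∈ S | q.2 = 0}.ncard = 2 * {q ∈ S | 0 ≤ q.2}.ncard := by
  have h1 : {q ∈ S | q.2 ≤ 0}.ncard = {q ∈ S | 0 ≤ q.2}.ncard := by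
    refine Set.BijOn.ncard_eq (f := fun q => (q.1, -q.2)) ⟨?_, ?_, ?_⟩
    · rintro q ⟨hq, h⟩
      exact ⟨hneg q hq, by simpa using h⟩
    · rintro ⟨x, y⟩ _ ⟨x', y'⟩ _ h
      simpa using h
    · rintro q ⟨hq, h⟩
      exact ⟨(q.1, -q.2), ⟨hneg q hq, by simpa using h⟩, by simp⟩
  have h2 := Set.ncard_union_add_ncard_inter {q ∈ S | q.2 ≤ 0} {q ∈ S | 0 ≤ q.2}
    (hS.subset fun _ h => h.1) (hS.subset fun _ h => h.1)
  have h3 : {q ∈ S | q.2 ≤ 0} ∪ {q ∈ S | 0 ≤ q.2} = S := by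
    ext q
    have := le_total q.2 0
    simp only [Set.mem_union, Set.mem_ofPred_eq]
    tauto
  have h4 : {q ∈ S | q.2 ≤ 0} ∩ {q ∈ S | 0 ≤ q.2} = {q ∈ S | q.2 = 0} := by
    ext q
    simp only [Set.mem_inter_iff, Set.mem_ofPred_eq]
    constructor
    · rintro ⟨⟨h, h1⟩, _, h2⟩
      exact ⟨h, le_antisymm h1 h2⟩
    · rintro ⟨h, h1⟩
      exact ⟨⟨h, h1.le⟩, h, h1.ge⟩
  rw [h3, h4, h1] at h2
  omega

/-- The representations of `u * s ^ 2 + v * n ^ 2` that correspond to decompositions of `n`. -/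
def parityReps (u v s n : ℤ) : Set (ℤ × ℤ) :=
  {q ∈ positiveReps u v (u * s ^ 2 + v * n ^ 2) | 2 ∣ n - q.2}

theorem parityReps_finite {u v : ℤ} (hu : 0 < u) (hv : 0 < v) (s n : ℤ) :
    (parityReps u v s n).Finite :=
  (positiveReps_finite hu hv _).subset fun _ h => h.1

theorem neg_snd_mem_parityReps {u v s n : ℤ} (q : ℤ × ℤ) (hq : q ∈ parityReps u v s n) :
    (q.1, -q.2) ∈ parityReps u v s n := by
  obtain ⟨⟨h1, h2⟩, h3⟩ := hq
  refine ⟨⟨h1, ?_⟩, ?_⟩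
  · simpa using h2
  · simp only; omega

/-- Completing the square: `σ` and `l` are the coefficients of the linear form in `c` whose square
appears in the equation `4 * a * b = 4 * t * P(m, c)`. -/
theorem polygonalRepCount_add_one {m t n : ℕ} (hn : 0 < n) {u v s l σ : ℤ} (hu : 0 < u)
    (hv : 0 < v) (hs : 0 < s)
    (hid : ∀ c, u * ((l * c - σ) ^ 2 - s ^ 2) = 4 * v * (t * polygonal m c))
    (hsol : ∀ q ∈ parityReps u v s n, s ≤ q.1 ∧
      (s < q.1 → ∃ c, IsPolygonalIndex m c ∧ (l * c - σ) ^ 2 = q.1 ^ 2)) :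
    polygonalRepCount m t n + 1 = {q ∈ parityReps u v s n | 0 ≤ q.2}.ncard := by
  -- This point corresponds to `a = 0` and accounts for the `+ 1`.
  have hmem : (s, (n : ℤ)) ∈ {q ∈ parityReps u v s n | 0 ≤ q.2} :=
    ⟨⟨⟨hs, rfl⟩, by simp⟩, by simp⟩
  rw [← Set.ncard_sdiff_singleton_add_one hmem ((parityReps_finite hu hv s n).subset fun _ h => h.1)]
  congr 1
  symm
  refine Set.BijOn.ncard_eq
    (f := fun q : ℤ × ℤ => (((n - q.2) / 2).toNat, ((n + q.2) / 2).toNat)) ⟨?_, ?_, ?_⟩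
  · rintro ⟨x, y⟩ ⟨⟨hq, hy⟩, hne⟩
    obtain ⟨h1, h2⟩ := hsol _ hq
    obtain ⟨⟨hx, hxy⟩, a, ha⟩ := hq
    simp only [Set.mem_singleton_iff, Prod.mk.injEq, not_and] at *
    -- Equality would force `y = n`, the removed point; strictness gives `y < n`, that is `a > 0`.
    have hsx : s < x := by
      refine lt_of_le_of_ne h1 fun h => hne h.symm ?_
      have : v * y ^ 2 = v * (n : ℤ) ^ 2 := by rw [← h] at hxy; linarith
      have := mul_left_cancel₀ hv.ne' this
      exact (sq_eq_sq₀ hy (by positivity)).1 this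
    have hyn : y < n := by
      refine lt_of_pow_lt_pow_left₀ 2 (by positivity) (lt_of_mul_lt_mul_left ?_ hv.le)
      have : u * s ^ 2 < u * x ^ 2 := by gcongr
      linarith
    obtain ⟨c, hc, hcx⟩ := h2 hsx
    have e1 : (n - y) / 2 = a := by omega
    have e2 : (n + y) / 2 = a + y := by omega
    rw [e1, e2]
    refine ⟨by simp only; omega, by simp only; omega, by simp only; omega, c, hc, ?_⟩
    simp only
    rw [Int.toNat_of_nonneg (by omega), Int.toNat_of_nonneg (by omega)]
    have h := hid c
    rw [hcx] at h
    refine mul_left_cancel₀ (by positivity : 4 * v ≠ 0) ?_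
    obtain rfl : y = n - 2 * a := by omega
    linear_combination h - hxy
  · rintro ⟨x, y⟩ ⟨⟨⟨⟨hx, hxy⟩, a, ha⟩, hy⟩, hne⟩ ⟨x', y'⟩ ⟨⟨⟨⟨hx', hxy'⟩, a', ha'⟩, hy'⟩, hne'⟩ h
    simp only [Prod.mk.injEq] at *
    obtain rfl : y = y' := by omega
    refine ⟨?_, rfl⟩
    have : u * x ^ 2 = u * x' ^ 2 := by linarith
    exact (sq_eq_sq₀ hx.le hx'.le).1 (mul_left_cancel₀ hu.ne' this)
  · rintro ⟨a, b⟩ ⟨ha, hab, hnab, c, hc, h⟩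
    simp only at ha hab hnab h
    have hz : (n : ℤ) = a + b := by exact_mod_cast hnab
    have hx2 : |l * c - σ| ^ 2 = (l * c - σ) ^ 2 := sq_abs _
    have hid' := hid c
    rw [← h] at hid'
    have hpos : (l * c - σ) ^ 2 > 0 := by
      have h1 : (0 : ℤ) < 4 * v * (a * b) := by
        have : (0 : ℤ) < a := by exact_mod_cast ha
        have : (0 : ℤ) < b := by omega
        positivity
      have h2 : s ^ 2 < (l * c - σ) ^ 2 := by
        rw [← hid'] at h1
        linarith [pos_of_mul_pos_right h1 hu.le]
      exact (sq_nonneg s).trans_lt h2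
    refine ⟨(|l * c - σ|, b - a), ⟨⟨⟨⟨?_, ?_⟩, ?_⟩, ?_⟩, ?_⟩, ?_⟩
    · exact abs_pos.2 fun h0 => by simp [h0] at hpos
    · simp only
      rw [hx2, hz]
      linear_combination hid'
    · simp only; omega
    · simp only; omega
    · simp only [Set.mem_singleton_iff, Prod.mk.injEq, not_and]; omega
    · simp only [Prod.mk.injEq]; omega

/-- At most one solution has `y = 0`, so the number `d` of solutions is `2r + 1` or `2r + 2`, where
`r` is the number of decompositions. -/
theorem polygonalRepCount_eq_floor {m t n : ℕ} (hn : 0 < n) {u v s l σ : ℤ} (hu : 0 < u)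
    (hv : 0 < v) (hs : 0 < s)
    (hid : ∀ c, u * ((l * c - σ) ^ 2 - s ^ 2) = 4 * v * (t * polygonal m c))
    (hsol : ∀ x y : ℤ, 0 < x → u * x ^ 2 + v * y ^ 2 = u * s ^ 2 + v * (n : ℤ) ^ 2 →
      2 ∣ n - y ∧ s ≤ x ∧ (s < x → ∃ c, IsPolygonalIndex m c ∧ (l * c - σ) ^ 2 = x ^ 2)) {N : ℕ}
    (hN : (N : ℤ) = u * s ^ 2 + v * (n : ℤ) ^ 2) {d : ℕ} (hd : (positiveReps u v N).ncard = d) :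
    (polygonalRepCount m t n : ℤ) = ⌊((d : ℚ) - 1) / 2⌋ := by
  have heq : parityReps u v s n = positiveReps u v N := by
    rw [hN]
    exact Set.sep_eq_self_iff_mem_true.2 fun q hq => (hsol q.1 q.2 hq.1 hq.2).1
  have h1 := polygonalRepCount_add_one (t := t) hn hu hv hs hid fun q hq =>
    (hsol q.1 q.2 hq.1.1 hq.1.2).2
  have h2 := ncard_add_ncard_eq_two_mul (parityReps_finite hu hv s n) neg_snd_mem_parityReps
  rw [heq] at h2 h1
  have h3 : {q ∈ positiveReps u v N | q.2 = 0}.ncard ≤ 1 := by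
    rw [Set.ncard_le_one ((positiveReps_finite hu hv _).subset fun _ h => h.1)]
    rintro ⟨x, y⟩ ⟨⟨hx, hxy⟩, hy⟩ ⟨x', y'⟩ ⟨⟨hx', hxy'⟩, hy'⟩
    simp only [Prod.mk.injEq] at *
    subst hy hy'
    refine ⟨?_, rfl⟩
    have : u * x ^ 2 = u * x' ^ 2 := by linarith
    exact (sq_eq_sq₀ hx.le hx'.le).1 (mul_left_cancel₀ hu.ne' this)
  symm
  rw [Int.floor_eq_iff]
  rw [hd] at h2
  have h4 : 2 * polygonalRepCount m t n + 1 ≤ d := by omega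
  have h5 : d ≤ 2 * polygonalRepCount m t n + 2 := by omega
  have h4' : (2 * polygonalRepCount m t n + 1 : ℚ) ≤ d := by exact_mod_cast h4
  have h5' : (d : ℚ) ≤ 2 * polygonalRepCount m t n + 2 := by exact_mod_cast h5
  push_cast
  constructor <;> linarith

/-! ### One class in the principal genus -/

/-- A reduced form has `3 a ^ 2 ≤ 4 k`, so finitely many `a`, `b` need checking. For the
determinants used, only `a = 1, 2` survive. -/
theorem oneClassInPrincipalGenus_of_bound {k : ℤ} (B : ℤ) (hB : 0 ≤ B)
    (hk : 4 * k < 3 * (B + 1) ^ 2)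
    (h : ∀ a ∈ Finset.Icc 1 B, ∀ b ∈ Finset.Icc (-B) B, 2 * |b| ≤ a → a ∣ b ^ 2 + k →
      a ^ 2 ≤ b ^ 2 + k → a = 1 ∨ a = 2)
    (h2 : k ≤ 2 ∨ ∀ B D N : ℤ, IsCoprime N (2 * k) → B ^ 2 + k * D ^ 2 ≠ 2 * N ^ 2) :
    OneClassInPrincipalGenus k := by
  intro a b c ha hac hb habc
  have hb0 := abs_nonneg b
  have hb2 : 4 * b ^ 2 ≤ a ^ 2 := by
    rw [← sq_abs b]
    nlinarith
  have haB : a ≤ B := by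
    by_contra hlt
    push Not at hlt
    have h1 : (B + 1) ^ 2 ≤ a ^ 2 := by gcongr; omega
    nlinarith
  have hbB := abs_le.1 (show |b| ≤ B by omega)
  rcases h a (Finset.mem_Icc.2 ⟨ha, haB⟩) b (Finset.mem_Icc.2 hbB) hb
    ⟨c, by linarith⟩ (by nlinarith) with h | rfl
  · exact Or.inl h
  · rcases h2 with h2 | h2
    · have : |b| ≤ 1 := by omega
      have := abs_le.1 this
      nlinarith
    · exact Or.inr h2

/-- The genus character at `p ∣ k` excludes `a = 2` when `2` is a nonresidue modulo `p`; this
applies to `3, 5, 11, 29`, all `±3` modulo `8`. -/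
theorem sq_add_mul_sq_ne_two_mul_sq {p : ℕ} (hp : p.Prime)
    (h : ∀ x y : ZMod p, x ^ 2 = 2 * y ^ 2 → y = 0) {k : ℤ} (hk : (p : ℤ) ∣ k) (B D N : ℤ)
    (hN : IsCoprime N (2 * k)) : B ^ 2 + k * D ^ 2 ≠ 2 * N ^ 2 := by
  intro heq
  have hk0 : ((k : ℤ) : ZMod p) = 0 := (ZMod.intCast_zmod_eq_zero_iff_dvd k p).2 hk
  have h1 := congrArg (Int.cast : ℤ → ZMod p) heq
  push_cast at h1
  rw [hk0, zero_mul, add_zero] at h1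
  have h2 := (ZMod.intCast_zmod_eq_zero_iff_dvd N p).1 (h _ _ h1)
  exact (Nat.prime_iff_prime_int.1 hp).not_isUnit (hN.isUnit_of_dvd' h2 (hk.mul_left 2))

theorem oneClassInPrincipalGenus_two : OneClassInPrincipalGenus 2 :=
  oneClassInPrincipalGenus_of_bound 1 (by norm_num) (by norm_num) (by decide) (by norm_num)

theorem oneClassInPrincipalGenus_four : OneClassInPrincipalGenus 4 := by
  refine oneClassInPrincipalGenus_of_bound 2 (by norm_num) (by norm_num) (by decide) (Or.inr ?_)
  -- Here the obstruction is 2-adic: `B`, and then `N`, would be even.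
  intro B D N hN h
  obtain ⟨a, b, hab⟩ := hN
  have hB : Even (B ^ 2) := ⟨N ^ 2 - 2 * D ^ 2, by linarith⟩
  obtain ⟨B', rfl⟩ := (Int.even_pow.1 hB).1
  have hN2 : Even (N ^ 2) := ⟨B' ^ 2 + D ^ 2, by linarith⟩
  obtain ⟨N', rfl⟩ := (Int.even_pow.1 hN2).1
  have : 2 * (a * N' + 4 * b) = 1 := by linarith
  omega

theorem oneClassInPrincipalGenus_six : OneClassInPrincipalGenus 6 :=
  oneClassInPrincipalGenus_of_bound 2 (by norm_num) (by norm_num) (by decide)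
    (Or.inr (sq_add_mul_sq_ne_two_mul_sq (p := 3) (by norm_num) (by decide) (by decide)))

theorem oneClassInPrincipalGenus_ten : OneClassInPrincipalGenus 10 :=
  oneClassInPrincipalGenus_of_bound 3 (by norm_num) (by norm_num) (by decide)
    (Or.inr (sq_add_mul_sq_ne_two_mul_sq (p := 5) (by norm_num) (by decide) (by decide)))

theorem oneClassInPrincipalGenus_twentyTwo : OneClassInPrincipalGenus 22 :=
  oneClassInPrincipalGenus_of_bound 5 (by norm_num) (by norm_num) (by decide)
    (Or.inr (sq_add_mul_sq_ne_two_mul_sq (p := 11) (by norm_num) (by decide) (by decide)))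

set_option maxRecDepth 4000 in
theorem oneClassInPrincipalGenus_fiftyEight : OneClassInPrincipalGenus 58 :=
  oneClassInPrincipalGenus_of_bound 8 (by norm_num) (by norm_num) (by decide)
    (Or.inr (sq_add_mul_sq_ne_two_mul_sq (p := 29) (by norm_num) (by decide) (by decide)))

theorem isInertFor_of_zmod {q : ℕ} {k : ℤ}
    (h : ∀ x y : ZMod q, x ^ 2 + (k : ZMod q) * y ^ 2 = 0 → x = 0 ∧ y = 0) : IsInertFor q k := by
  intro x y hxy
  rw [← ZMod.intCast_zmod_eq_zero_iff_dvd] at hxy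
  push_cast at hxy
  have := h _ _ hxy
  rwa [ZMod.intCast_zmod_eq_zero_iff_dvd, ZMod.intCast_zmod_eq_zero_iff_dvd] at this

theorem mem_of_prime_dvd {A : Finset ℕ} (hA : ∀ q ∈ A, q.Prime) {z : ℤ} (j : ℕ)
    (hz : z ∣ (∏ q ∈ A, (q : ℤ)) ^ j) (l : ℕ) (hl : l.Prime) (hlz : (l : ℤ) ∣ z) : l ∈ A := by
  have h : (l : ℤ) ∣ ∏ q ∈ A, (q : ℤ) :=
    (Nat.prime_iff_prime_int.1 hl).dvd_of_dvd_pow (hlz.trans hz)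
  obtain ⟨q, hq, hlq⟩ := ((Nat.prime_iff_prime_int.1 hl).dvd_finsetProd_iff _).1 h
  rwa [(Nat.prime_dvd_prime_iff_eq hl (hA q hq)).1 (by exact_mod_cast hlq)]

/-! ### Recovering the polygonal index -/

/-- Such an `x` is `±r` plus an odd multiple of `M`, positive since `r < M`; so `x` or `-x` is
congruent to `-(M - r)` modulo `2M`. Negative indices `c` are needed. -/
theorem exists_linear_sq_eq {M r x : ℤ} (hM : Odd M) (hr : 0 < r) (hrM : r < M) (hx : 0 < x)
    (hpar : Odd (x - r)) (h : M ∣ x - r ∨ M ∣ x + r) :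
    M - r ≤ x ∧ ∃ c : ℤ, (2 * M * c - (M - r)) ^ 2 = x ^ 2 := by
  obtain ⟨i, hi⟩ := hpar
  obtain ⟨w, hw⟩ := hM
  rcases h with ⟨j, hj⟩ | ⟨j, hj⟩
  · have hjo : Odd j := by
      have : Odd (M * j) := ⟨i, by linarith⟩
      exact (Int.odd_mul.1 this).2
    obtain ⟨e, rfl⟩ := hjo
    have he : 0 ≤ e := by
      by_contra hlt
      push Not at hlt
      nlinarith
    exact ⟨by nlinarith, e + 1, by
      rw [show x = r + M * (2 * e + 1) by linarith]; ring⟩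
  · have hjo : Odd j := by
      have : Odd (M * j) := ⟨i + r, by linarith⟩
      exact (Int.odd_mul.1 this).2
    obtain ⟨e, rfl⟩ := hjo
    have he : 0 ≤ e := by
      by_contra hlt
      push Not at hlt
      nlinarith
    exact ⟨by nlinarith, -e, by
      rw [show x = -r + M * (2 * e + 1) by linarith]; ring⟩

theorem Int.two_dvd_sub_of_sq {n y : ℤ} (h : 2 ∣ n ^ 2 - y ^ 2) : 2 ∣ n - y := by
  have h1 : Even (n ^ 2 - y ^ 2) := even_iff_two_dvd.2 h
  rw [Int.even_sub, Int.even_pow' two_ne_zero, Int.even_pow' two_ne_zero, ← Int.even_sub] at h1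
  exact even_iff_two_dvd.1 h1

/-- `(2Mc - (M - 2)) ^ 2 - (M - 2) ^ 2 = 8M P(M + 2, c)`. Modulo the prime `M` the equation reads `x
^ 2 = 4`, hence `r = 2`. -/
theorem polygonalRepCount_of_one {M : ℕ} (hM : M.Prime) (hM2 : 2 < M) {n : ℕ} (hn : 0 < n)
    {N : ℕ} (hN : (N : ℤ) = 1 * ((M : ℤ) - 2) ^ 2 + 2 * M * (n : ℤ) ^ 2) {d : ℕ}
    (hd : (positiveReps 1 (2 * M) N).ncard = d) :
    (polygonalRepCount (M + 2) 1 n : ℤ) = ⌊((d : ℚ) - 1) / 2⌋ := by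
  have hMz : (2 : ℤ) < M := by exact_mod_cast hM2
  have hodd : Odd (M : ℤ) := by exact_mod_cast hM.odd_of_ne_two hM2.ne'
  refine polygonalRepCount_eq_floor (l := 2 * M) (σ := (M : ℤ) - 2) hn one_pos (by linarith)
    (by linarith) (fun c => ?_) (fun x y hx hxy => ?_) hN hd
  · have h := two_mul_polygonal (M + 2) c
    push_cast at h ⊢
    linear_combination -(4 * (M : ℤ)) * h
  · have hdvd : (M : ℤ) ∣ (x - 2) * (x + 2) :=
      ⟨M - 4 + 2 * (n : ℤ) ^ 2 - 2 * y ^ 2, by linear_combination hxy⟩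
    obtain ⟨w, hw⟩ := hodd
    have hxo : Odd x := by
      have : Odd (x ^ 2) := ⟨2 * w ^ 2 - 2 * w + M * n ^ 2 - M * y ^ 2, by
        rw [hw] at hxy ⊢; linear_combination hxy⟩
      exact (Int.odd_pow' two_ne_zero).1 this
    obtain ⟨h1, c, hc⟩ := exists_linear_sq_eq (M := M) (r := 2) (x := x) ⟨w, hw⟩ two_pos hMz hx
      (by obtain ⟨i, hi⟩ := hxo; exact ⟨i - 1, by rw [hi]; ring⟩)
      ((Nat.prime_iff_prime_int.1 hM).dvd_or_dvd hdvd)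
    refine ⟨Int.two_dvd_sub_of_sq ?_, h1, fun _ => ⟨c, fun h => by omega, hc⟩⟩
    obtain ⟨i, hi⟩ := hxo
    have h4 : IsCoprime (2 : ℤ) M := ⟨-w, 1, by rw [hw]; ring⟩
    refine h4.dvd_of_dvd_mul_left ⟨i ^ 2 + i - w ^ 2 + w, ?_⟩
    have h5 : (2 : ℤ) * (M * ((n : ℤ) ^ 2 - y ^ 2)) = 2 * (2 * (i ^ 2 + i - w ^ 2 + w)) := by
      rw [hi, hw] at hxy
      rw [hw]
      linear_combination -hxy
    linarith

/-- `2 ((2Mc - (M - 1)) ^ 2 - (M - 1) ^ 2) = 8M P(2M + 2, c)`. Modulo `M` the equation reads `x ^ 2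
= 1`, hence `r = 1`. -/
theorem polygonalRepCount_of_two {M : ℕ} (hM : M.Prime) (hM2 : 2 < M) {n : ℕ} (hn : 0 < n)
    {N : ℕ} (hN : (N : ℤ) = 2 * ((M : ℤ) - 1) ^ 2 + M * (n : ℤ) ^ 2) {d : ℕ}
    (hd : (positiveReps 2 M N).ncard = d) :
    (polygonalRepCount (2 * M + 2) 2 n : ℤ) = ⌊((d : ℚ) - 1) / 2⌋ := by
  have hMz : (2 : ℤ) < M := by exact_mod_cast hM2
  have hodd : Odd (M : ℤ) := by exact_mod_cast hM.odd_of_ne_two hM2.ne'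
  refine polygonalRepCount_eq_floor (l := 2 * M) (σ := (M : ℤ) - 1) hn two_pos (by linarith)
    (by linarith) (fun c => ?_) (fun x y hx hxy => ?_) hN hd
  · have h := two_mul_polygonal (2 * M + 2) c
    push_cast at h ⊢
    linear_combination -(4 * (M : ℤ)) * h
  · obtain ⟨w, hw⟩ := hodd
    have hc2 : IsCoprime (2 : ℤ) M := ⟨-w, 1, by rw [hw]; ring⟩
    have hny : (2 : ℤ) ∣ n - y := Int.two_dvd_sub_of_sq
      (hc2.dvd_of_dvd_mul_left ⟨x ^ 2 - (M - 1) ^ 2, by linear_combination -hxy⟩)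
    have hdvd : (M : ℤ) ∣ (x - 1) * (x + 1) :=
      hc2.symm.dvd_of_dvd_mul_left ⟨2 * M - 4 + (n : ℤ) ^ 2 - y ^ 2, by linear_combination hxy⟩
    have hxe : Even x := by
      obtain ⟨i, hi⟩ := hny
      have hy : y = n - 2 * i := by linarith
      have : Even (x ^ 2) := by
        refine ⟨2 * w ^ 2 + M * (n * i - i ^ 2), ?_⟩
        rw [hy, hw] at hxy
        rw [hw]
        linarith
      exact (Int.even_pow' two_ne_zero).1 this
    obtain ⟨h1, c, hc⟩ := exists_linear_sq_eq (M := M) (r := 1) (x := x) ⟨w, hw⟩ one_pos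
      (by linarith) hx (by obtain ⟨i, hi⟩ := hxe; exact ⟨i - 1, by rw [hi]; ring⟩)
      ((Nat.prime_iff_prime_int.1 hM).dvd_or_dvd hdvd)
    exact ⟨hny, h1, fun _ => ⟨c, fun h => by omega, hc⟩⟩

/-- `8 P(3, c) + 1 = (2c + 1) ^ 2`; the value `x = 1` is the excluded index `c = 0`. -/
theorem exists_triangular_index {x : ℤ} (hx : Odd x) (hx0 : 0 < x) :
    1 ≤ x ∧ (1 < x → ∃ c, IsPolygonalIndex 3 c ∧ (2 * c - -1) ^ 2 = x ^ 2) := by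
  obtain ⟨i, rfl⟩ := hx
  exact ⟨by omega, fun h => ⟨i, fun _ => by omega, by ring⟩⟩

theorem polygonalRepCount_three {t : ℕ} (ht : Odd t) {n : ℕ} (hn : 0 < n)
    {N : ℕ} (hN : (N : ℤ) = t * 1 ^ 2 + 2 * (n : ℤ) ^ 2) {d : ℕ}
    (hd : (positiveReps t 2 N).ncard = d) :
    (polygonalRepCount 3 t n : ℤ) = ⌊((d : ℚ) - 1) / 2⌋ := by
  have htz : (0 : ℤ) < t := by exact_mod_cast ht.pos
  have hodd : Odd (t : ℤ) := by exact_mod_cast ht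
  refine polygonalRepCount_eq_floor (l := 2) (σ := -1) hn htz two_pos one_pos
    (fun c => ?_) (fun x y hx hxy => ?_) hN hd
  · have h := two_mul_polygonal 3 c
    push_cast at h ⊢
    linear_combination -(4 * (t : ℤ)) * h
  · have hxo : Odd x := by
      obtain ⟨w, hw⟩ := hodd
      have : Odd (t * x ^ 2) := ⟨w + n ^ 2 - y ^ 2, by linear_combination hxy + hw⟩
      exact (Int.odd_pow' two_ne_zero).1 (Int.odd_mul.1 this).2
    refine ⟨Int.two_dvd_sub_of_sq ?_, exists_triangular_index hxo hx⟩
    obtain ⟨i, rfl⟩ := hxo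
    exact ⟨t * (i ^ 2 + i), by linarith⟩

/-! ### Sums of two squares: the case `m = 3`, `t = 2` -/

/-- Here `n ^ 2 + 1 = 2N`, and `(p + 2q) ^ 2 + (p - 2q) ^ 2 = 2 (p ^ 2 + 4 q ^ 2)`. Passing to `x ^
2 + 4 y ^ 2` removes the extra automorphism of `x ^ 2 + y ^ 2`. -/
theorem ncard_nonneg_parityReps_of_odd {w : ℤ} {N : ℕ} (hN : (N : ℤ) = 2 * w ^ 2 + 2 * w + 1) :
    {q ∈ parityReps 1 1 1 (2 * w + 1) | 0 ≤ q.2}.ncard = (positiveReps 1 4 N).ncard := by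
  symm
  refine Set.BijOn.ncard_eq
    (f := fun q : ℤ × ℤ => (|q.1 + 2 * q.2|, |q.1 - 2 * q.2|)) ⟨?_, ?_, ?_⟩
  · rintro ⟨p, q⟩ ⟨hp, hpq⟩
    simp only at hp hpq
    have hodd : Odd p := by
      have : Odd (p ^ 2) := ⟨w ^ 2 + w - 2 * q ^ 2, by linarith⟩
      exact (Int.odd_pow' two_ne_zero).1 this
    obtain ⟨i, rfl⟩ := hodd
    refine ⟨⟨⟨abs_pos.2 (by omega), ?_⟩, ?_⟩, abs_nonneg _⟩
    · simp only [sq_abs]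
      linear_combination 2 * hpq + 2 * hN
    · simp only
      rcases abs_cases (2 * i + 1 - 2 * q) with h | h <;> omega
  · rintro ⟨p, q⟩ ⟨hp, hpq⟩ ⟨p', q'⟩ ⟨hp', hpq'⟩ h
    simp only [Prod.mk.injEq] at *
    have hodd : ∀ p q : ℤ, 1 * p ^ 2 + 4 * q ^ 2 = N → Odd p := fun p q h => by
      have : Odd (p ^ 2) := ⟨w ^ 2 + w - 2 * q ^ 2, by linarith⟩
      exact (Int.odd_pow' two_ne_zero).1 this
    obtain ⟨i, rfl⟩ := hodd _ _ hpq
    obtain ⟨j, rfl⟩ := hodd _ _ hpq'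
    rcases abs_eq_abs.1 h.1 with h1 | h1 <;> rcases abs_eq_abs.1 h.2 with h2 | h2 <;> omega
  · rintro ⟨x, y⟩ ⟨⟨⟨hx, hxy⟩, a, ha⟩, hy⟩
    simp only at hx hxy ha hy
    obtain ⟨i, rfl⟩ : ∃ i, y = 2 * i + 1 := ⟨w - a, by omega⟩
    have hodd : Odd x := by
      have : Odd (x ^ 2) := ⟨2 * w ^ 2 + 2 * w - 2 * i ^ 2 - 2 * i, by linarith⟩
      exact (Int.odd_pow' two_ne_zero).1 this
    obtain ⟨j, rfl⟩ := hodd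
    -- Exactly one of `(x + y) / 2` and `(x - y) / 2` is odd; its absolute value is the required
    -- `p`.
    rcases Int.even_or_odd' (i + j) with ⟨k, hk | hk⟩
    · obtain rfl : j = 2 * k - i := by omega
      refine ⟨(2 * k + 1, k - i), ⟨by simp only; omega, ?_⟩, ?_⟩
      · simp only
        rw [hN]
        linarith
      · simp only [Prod.mk.injEq]
        exact ⟨by rw [abs_of_nonneg] <;> omega, by rw [abs_of_nonneg] <;> omega⟩
    · obtain rfl : j = 2 * k + 1 - i := by omega
      rcases le_or_gt i k with h | h
      · refine ⟨(2 * (k - i) + 1, k + 1), ⟨by simp only; omega, ?_⟩, ?_⟩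
        · simp only
          rw [hN]
          linarith
        · simp only [Prod.mk.injEq]
          exact ⟨by rw [abs_of_nonneg] <;> omega, by rw [abs_of_nonpos] <;> omega⟩
      · refine ⟨(2 * (i - k) - 1, -(k + 1)), ⟨by simp only; omega, ?_⟩, ?_⟩
        · simp only
          rw [hN]
          linarith
        · simp only [Prod.mk.injEq]
          exact ⟨by rw [abs_of_nonpos] <;> omega, by rw [abs_of_nonneg] <;> omega⟩

theorem ncard_positiveReps_one_four {s n : ℤ} {N : ℕ} (hN0 : 0 < N)
    (hN : (N : ℤ) = 1 * s ^ 2 + 4 * n ^ 2) (hs : Odd s) (hn : IsCoprime (N : ℤ) n)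
    (hNs : IsCoprime (N : ℤ) s) : (positiveReps 1 4 N).ncard = N.divisors.card := by
  refine ncard_positiveReps_of_coprime one_pos (by norm_num) hN0 hN hn hNs ?_
    oneClassInPrincipalGenus_four
  obtain ⟨i, rfl⟩ := hs
  have h : IsCoprime (N : ℤ) 2 := ⟨1, -(2 * i ^ 2 + 2 * i + 2 * n ^ 2), by rw [hN]; ring⟩
  exact (h.pow_right (n := 3) : IsCoprime (N : ℤ) (2 ^ 3))

theorem two_mul_ncard_nonneg_parityReps {n : ℕ} (hn : 0 < n) :
    2 * {q ∈ parityReps 1 1 1 (n : ℤ) | 0 ≤ q.2}.ncard = (n ^ 2 + 1).divisors.card := by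
  rcases Nat.even_or_odd' n with ⟨w, rfl | rfl⟩
  · rw [← ncard_add_ncard_eq_two_mul (parityReps_finite one_pos one_pos _ _)
      neg_snd_mem_parityReps]
    -- No fixed point of `y ↦ -y`: `n ^ 2 + 1` is not a square for `n > 0`.
    have h0 : {q ∈ parityReps 1 1 1 ((2 * w : ℕ) : ℤ) | q.2 = 0} = ∅ := by
      rw [Set.eq_empty_iff_forall_notMem]
      rintro ⟨x, y⟩ ⟨⟨⟨hx, hxy⟩, -⟩, hy⟩
      simp only at hx hxy hy
      subst hy
      push_cast at hxy
      have hw : (0 : ℤ) < w := by omega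
      have h1 : x < 2 * w + 1 := by nlinarith
      have h2 : (2 * w : ℤ) < x := by nlinarith
      omega
    rw [h0, Set.ncard_empty, add_zero, ← ncard_positiveReps_one_four (s := 1) (n := w)
      (by positivity) (by push_cast; ring) odd_one ⟨1, -(4 * w), by push_cast; ring⟩
      isCoprime_one_right]
    symm
    refine Set.BijOn.ncard_eq (f := fun q : ℤ × ℤ => (q.1, 2 * q.2)) ⟨?_, ?_, ?_⟩
    · rintro ⟨x, y⟩ ⟨hx, hxy⟩
      refine ⟨⟨hx, ?_⟩, ?_⟩
      · push_cast at hxy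
        push_cast
        linarith
      · push_cast
        omega
    · rintro ⟨x, y⟩ _ ⟨x', y'⟩ _ h
      simpa using h
    · rintro ⟨x, y⟩ ⟨⟨hx, hxy⟩, a, ha⟩
      push_cast at hxy ha
      obtain rfl : y = 2 * (w - a) := by omega
      exact ⟨(x, w - a), ⟨hx, by push_cast; linarith⟩, rfl⟩
  · push_cast
    rw [ncard_nonneg_parityReps_of_odd (N := 2 * w ^ 2 + 2 * w + 1) (by push_cast; ring)]
    have hmul : (2 * w + 1) ^ 2 + 1 = 2 * (2 * w ^ 2 + 2 * w + 1) := by ring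
    have hcop : Nat.Coprime 2 (2 * w ^ 2 + 2 * w + 1) :=
      (Nat.coprime_two_left).2 ⟨w ^ 2 + w, by ring⟩
    rw [hmul, hcop.card_divisors_mul, Nat.prime_two.divisors,
      Finset.card_pair (by norm_num)]
    congr 1
    -- `N = w ^ 2 + (w + 1) ^ 2`, and the even one of the two provides the term `4 n ^ 2`.
    rcases Nat.even_or_odd' w with ⟨z, rfl | rfl⟩
    · exact ncard_positiveReps_one_four (s := 2 * z + 1) (n := z) (by positivity)
        (by push_cast; ring) ⟨z, rfl⟩ ⟨1, -(8 * z + 4), by push_cast; ring⟩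
        ⟨1, -(4 * z), by push_cast; ring⟩
    · exact ncard_positiveReps_one_four (s := 2 * z + 1) (n := z + 1) (by positivity)
        (by push_cast; ring) ⟨z, rfl⟩ ⟨1, -(8 * z + 4), by push_cast; ring⟩
        ⟨1, -(4 * z + 4), by push_cast; ring⟩

theorem polygonalRepCount_three_two {n : ℕ} (hn : 0 < n) :
    (polygonalRepCount 3 2 n : ℚ) = ((n ^ 2 + 1).divisors.card : ℚ) / 2 - 1 := by
  have h1 := two_mul_ncard_nonneg_parityReps hn
  rw [← polygonalRepCount_add_one (m := 3) (t := 2) (l := 2) (σ := -1) hn one_pos one_pos one_pos]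
    at h1
  · rw [← h1]
    push_cast
    ring
  · intro c
    have h := two_mul_polygonal 3 c
    push_cast at h ⊢
    linear_combination -4 * h
  · rintro ⟨x, y⟩ ⟨⟨hx, hxy⟩, i, hi⟩
    simp only at hx hxy hi
    refine exists_triangular_index ?_ hx
    obtain rfl : y = n - 2 * i := by omega
    have : Odd (x ^ 2) := ⟨2 * n * i - 2 * i ^ 2, by linarith⟩
    exact (Int.odd_pow' two_ne_zero).1 this

/-! ### The fourteen cases -/

theorem numDivisorsAway_empty {N : ℕ} (hN : N ≠ 0) :
    numDivisorsAway ∅ N = N.divisors.card :=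
  numDivisorsAway_eq_card_divisors hN (by simp)

theorem prime_of_mem_singleton {p : ℕ} (hp : p.Prime) : ∀ q ∈ ({p} : Finset ℕ), q.Prime := by
  simpa using hp

theorem prime_of_mem_pair {p r : ℕ} (hp : p.Prime) (hr : r.Prime) :
    ∀ q ∈ ({p, r} : Finset ℕ), q.Prime := by
  simpa using ⟨hp, hr⟩

/-- The case in which the form is `x ^ 2 + k * y ^ 2` and `3` is inert. -/
theorem ncard_positiveReps_three_inert {k : ℤ} (hk0 : 0 < k) (hk2 : 2 ∣ k)
    (hcl : OneClassInPrincipalGenus k) (hin : IsInertFor 3 k) (j : ℕ) {n N : ℕ} (hN0 : 0 < N)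
    (hN : (N : ℤ) = 1 * (3 ^ j) ^ 2 + k * (n : ℤ) ^ 2) :
    (positiveReps 1 k N).ncard = numDivisorsAway {3} N :=
  ncard_positiveReps_eq_numDivisorsAway (prime_of_mem_singleton Nat.prime_three) hk2 hcl
    Nat.prime_two hk2 (by simp) (by simpa using Or.inr hin) N hN0 1 k (3 ^ j) n one_pos hk0
    (one_mul k) (mem_of_prime_dvd (prime_of_mem_singleton Nat.prime_three) j (by simp)) hN

/-- The case in which the form is `t * x ^ 2 + 2 * y ^ 2` with an odd prime `t`. -/
theorem ncard_positiveReps_prime_two {t : ℕ} (ht : t.Prime) (ht2 : t ≠ 2)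
    (hcl : OneClassInPrincipalGenus (t * 2)) {n : ℕ} :
    (positiveReps t 2 (2 * n ^ 2 + t : ℕ)).ncard = numDivisorsAway {t} (2 * n ^ 2 + t) := by
  have ht0 : 0 < t := ht.pos
  refine ncard_positiveReps_eq_numDivisorsAway (prime_of_mem_singleton ht) ⟨t, mul_comm _ _⟩ hcl
    Nat.prime_two ⟨t, mul_comm _ _⟩ (by simpa using ht2.symm) ?_ _ (by positivity) t 2 1 n
    (by exact_mod_cast ht0) two_pos rfl
    (mem_of_prime_dvd (prime_of_mem_singleton ht) 1 (by simp)) (by push_cast; ring)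
  simp only [Finset.mem_singleton, forall_eq]
  refine Or.inl ⟨dvd_mul_right _ _, fun h => ht2 ?_⟩
  have h' : (t : ℤ) ∣ (2 : ℕ) := Int.dvd_of_mul_dvd_mul_left (by exact_mod_cast ht0.ne') h
  exact (Nat.prime_dvd_prime_iff_eq ht Nat.prime_two).1 (by exact_mod_cast h')

/-- The case in which the form is `2 * x ^ 2 + M * y ^ 2` with an odd prime `M`. -/
theorem ncard_positiveReps_two_prime {M : ℕ} (hM : M.Prime) (hM2 : M ≠ 2) {A : Finset ℕ}
    (hA : ∀ q ∈ A, q.Prime) (hMA : M ∉ A) (hcl : OneClassInPrincipalGenus (2 * M))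
    (hin : ∀ q ∈ A, q = 2 ∨ IsInertFor q (2 * M)) {s : ℤ}
    (hs : 2 * s ∣ (∏ q ∈ A, (q : ℤ)) ^ 4) {n N : ℕ} (hN0 : 0 < N)
    (hN : (N : ℤ) = 2 * s ^ 2 + M * (n : ℤ) ^ 2) :
    (positiveReps 2 M N).ncard = numDivisorsAway A N := by
  refine ncard_positiveReps_eq_numDivisorsAway hA ⟨M, rfl⟩ hcl hM ⟨2, mul_comm _ _⟩ hMA
    (fun q hq => (hin q hq).imp_left ?_) N hN0 2 M s n two_pos (by exact_mod_cast hM.pos) rfl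
    (mem_of_prime_dvd hA 4 hs) hN
  rintro rfl
  refine ⟨⟨M, rfl⟩, fun h => hM2 ?_⟩
  have h' : ((2 : ℕ) : ℤ) ∣ M := Int.dvd_of_mul_dvd_mul_left two_ne_zero h
  exact ((Nat.prime_dvd_prime_iff_eq Nat.prime_two hM).1 (by exact_mod_cast h')).symm

/-- The case in which the form is `x ^ 2 + k * y ^ 2` and the represented number is coprime
to `2 * k`. -/
theorem ncard_positiveReps_one {k : ℕ} (hk0 : 0 < k) (hk2 : 2 ∣ k)
    (hcl : OneClassInPrincipalGenus k) {n : ℕ} :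
    (positiveReps 1 k (k * n ^ 2 + 1 : ℕ)).ncard = (k * n ^ 2 + 1).divisors.card := by
  rw [← numDivisorsAway_empty (by positivity)]
  refine ncard_positiveReps_eq_numDivisorsAway (by simp) (by exact_mod_cast hk2) hcl Nat.prime_two
    (by exact_mod_cast hk2) (by simp) (by simp) _ (by positivity) 1 k 1 n one_pos
    (by exact_mod_cast hk0) (one_mul _)
    (mem_of_prime_dvd (by simp) 0 (by simp)) (by push_cast; ring)

theorem theorem3 (n : ℕ) (hn : 0 < n) :
    (polygonalRepCount 3 1 n : ℤ) = ⌊(((2 * n ^ 2 + 1).divisors.card : ℚ) - 1) / 2⌋ ∧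
    (polygonalRepCount 5 1 n : ℤ) = ⌊(((6 * n ^ 2 + 1).divisors.card : ℚ) - 1) / 2⌋ ∧
    (polygonalRepCount 7 1 n : ℤ) = ⌊((numDivisorsAway {3} (10 * n ^ 2 + 9) : ℚ) - 1) / 2⌋ ∧
    (polygonalRepCount 13 1 n : ℤ) = ⌊((numDivisorsAway {3} (22 * n ^ 2 + 81) : ℚ) - 1) / 2⌋ ∧
    (polygonalRepCount 31 1 n : ℤ) = ⌊((numDivisorsAway {3} (58 * n ^ 2 + 729) : ℚ) - 1) / 2⌋ ∧
    (polygonalRepCount 3 2 n : ℚ) = ((n ^ 2 + 1).divisors.card : ℚ) / 2 - 1 ∧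
    (polygonalRepCount 8 2 n : ℤ) = ⌊((numDivisorsAway {2} (3 * n ^ 2 + 8) : ℚ) - 1) / 2⌋ ∧
    (polygonalRepCount 12 2 n : ℤ) = ⌊((numDivisorsAway {2} (5 * n ^ 2 + 32) : ℚ) - 1) / 2⌋ ∧
    (polygonalRepCount 24 2 n : ℤ) = ⌊((numDivisorsAway {2, 5} (11 * n ^ 2 + 200) : ℚ) - 1) / 2⌋ ∧
    (polygonalRepCount 60 2 n : ℤ) =
      ⌊((numDivisorsAway {2, 7} (29 * n ^ 2 + 1568) : ℚ) - 1) / 2⌋ ∧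
    (polygonalRepCount 3 3 n : ℤ) = ⌊((numDivisorsAway {3} (2 * n ^ 2 + 3) : ℚ) - 1) / 2⌋ ∧
    (polygonalRepCount 3 5 n : ℤ) = ⌊((numDivisorsAway {5} (2 * n ^ 2 + 5) : ℚ) - 1) / 2⌋ ∧
    (polygonalRepCount 3 11 n : ℤ) = ⌊((numDivisorsAway {11} (2 * n ^ 2 + 11) : ℚ) - 1) / 2⌋ ∧
    (polygonalRepCount 3 29 n : ℤ) = ⌊((numDivisorsAway {29} (2 * n ^ 2 + 29) : ℚ) - 1) / 2⌋ := by
  have p5 : Nat.Prime 5 := by norm_num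
  have p7 : Nat.Prime 7 := by norm_num
  have p11 : Nat.Prime 11 := by norm_num
  have p29 : Nat.Prime 29 := by norm_num
  have s2 := prime_of_mem_singleton Nat.prime_two
  refine ⟨?_, ?_, ?_, ?_, ?_, polygonalRepCount_three_two hn, ?_, ?_, ?_, ?_, ?_, ?_, ?_, ?_⟩
  · exact polygonalRepCount_three odd_one hn (by push_cast; ring)
      (ncard_positiveReps_one (k := 2) two_pos (by norm_num) oneClassInPrincipalGenus_two)
  · exact polygonalRepCount_of_one Nat.prime_three (by norm_num) hn (by push_cast; ring)
      (ncard_positiveReps_one (k := 6) (by norm_num) (by norm_num) oneClassInPrincipalGenus_six)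
  · exact polygonalRepCount_of_one p5 (by norm_num) hn (by push_cast; ring)
      (ncard_positiveReps_three_inert (by norm_num) (by norm_num) oneClassInPrincipalGenus_ten
        (isInertFor_of_zmod (by decide)) 1 (n := n) (by positivity) (by push_cast; ring))
  · exact polygonalRepCount_of_one p11 (by norm_num) hn (by push_cast; ring)
      (ncard_positiveReps_three_inert (by norm_num) (by norm_num) oneClassInPrincipalGenus_twentyTwo
        (isInertFor_of_zmod (by decide)) 2 (n := n) (by positivity) (by push_cast; ring))
  · exact polygonalRepCount_of_one p29 (by norm_num) hn (by push_cast; ring)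
      (ncard_positiveReps_three_inert (by norm_num) (by norm_num)
        oneClassInPrincipalGenus_fiftyEight (isInertFor_of_zmod (by decide)) 3 (n := n)
        (by positivity) (by push_cast; ring))
  · exact polygonalRepCount_of_two Nat.prime_three (by norm_num) hn (by push_cast; ring)
      (ncard_positiveReps_two_prime (s := 2) (n := n) Nat.prime_three (by norm_num) s2 (by simp)
        oneClassInPrincipalGenus_six (by simp) (by simp) (by positivity)
        (by push_cast; ring))
  · exact polygonalRepCount_of_two p5 (by norm_num) hn (by push_cast; ring)
      (ncard_positiveReps_two_prime (s := 4) (n := n) p5 (by norm_num) s2 (by simp)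
        oneClassInPrincipalGenus_ten (by simp) (by simp) (by positivity)
        (by push_cast; ring))
  -- `2s = 20`, so `A = {2, 5}`: `2` is ramified and `5` is inert for `k = 22`. Below, `2s = 56` and
  -- `7` is inert for `k = 58`.
  · exact polygonalRepCount_of_two p11 (by norm_num) hn (by push_cast; ring)
      (ncard_positiveReps_two_prime (s := 10) (n := n) p11 (by norm_num)
        (prime_of_mem_pair Nat.prime_two p5) (by simp) oneClassInPrincipalGenus_twentyTwo
        (by simpa using (isInertFor_of_zmod (q := 5) (k := 22) (by decide)))
        (by simp) (by positivity) (by push_cast; ring))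
  · exact polygonalRepCount_of_two p29 (by norm_num) hn (by push_cast; ring)
      (ncard_positiveReps_two_prime (s := 28) (n := n) p29 (by norm_num)
        (prime_of_mem_pair Nat.prime_two p7) (by simp) oneClassInPrincipalGenus_fiftyEight
        (by simpa using (isInertFor_of_zmod (q := 7) (k := 58) (by decide)))
        (by simp) (by positivity) (by push_cast; ring))
  · exact polygonalRepCount_three (by decide) hn (by push_cast; ring)
      (ncard_positiveReps_prime_two Nat.prime_three (by norm_num) oneClassInPrincipalGenus_six)
  · exact polygonalRepCount_three (by decide) hn (by push_cast; ring)
      (ncard_positiveReps_prime_two p5 (by norm_num) oneClassInPrincipalGenus_ten)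
  · exact polygonalRepCount_three (by decide) hn (by push_cast; ring)
      (ncard_positiveReps_prime_two p11 (by norm_num) oneClassInPrincipalGenus_twentyTwo)
  · exact polygonalRepCount_three (by decide) hn (by push_cast; ring)
      (ncard_positiveReps_prime_two p29 (by norm_num) oneClassInPrincipalGenus_fiftyEight)
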